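/- Let $\lambda\in(0,1)$ and $\beta>0$. Let $\xi_y$, $y\in\{1,2,\dots\}^2$, be i.i.d. random variables with the geometric law $P(\xi_y=k)=(1-\lambda)\lambda^k$, $k=0,1,2,\dots$. For integers $N,M\ge 1$ let $G(N,M)$ be the maximum of $\sum_{j=1}^{N+M-1}\xi_{y_j}$ over all oriented paths $(y_1,\dots,y_{N+M-1})$ from $(1,1)$ to $(N,M)$, that is, over all paths whose increments $y_{j+1}-y_j$ belong to $\{(1,0),(0,1)\}$; set $G(N,0)=0$. Then almost surely $$\lim_{N\to\infty}\frac1N\,G(N,\lfloor\beta N\rfloor)=\frac{(1+\sqrt{\beta\lambda})^2}{1-\lambda}-1 .$$ Moreover, for each $\delta>0$ there exist constants $c>0$ and $C>0$, depending only on $\delta$, $\lambda$ and $\beta$, such that for all integers $N\ge 1$ $$P\left\{\left|\frac1N\,G(N,\lfloor\beta N\rfloor)-\left(\frac{(1+\sqrt{\beta\lambda})^2}{1-\lambda}-1\right)\right|>\delta\right\}\le C\,e^{-cN}.$$ -/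

import Mathlib

open MeasureTheory ProbabilityTheory Filter Topology

universe u

/-- One step of an oriented path in `{1, 2, …}²`: exactly one coordinate increases, by one. -/
def OrientedStep (a b : ℕ+ × ℕ+) : Prop :=
  b = (a.1 + 1, a.2) ∨ b = (a.1, a.2 + 1)

/-- `p` is (the list of sites of) an oriented path from `(1, 1)` to `(N, M)`.
There is none when `N = 0` or `M = 0`. -/
structure IsOrientedPath (N M : ℕ) (p : List (ℕ+ × ℕ+)) : Prop where
  chain : p.IsChain OrientedStep
  start : p.head? = some (1, 1)
  finish : ∃ e : ℕ+ × ℕ+, p.getLast? = some e ∧ (e.1 : ℕ) = N ∧ (e.2 : ℕ) = M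

/-- The last passage percolation value `G(N, M)` for the weights `w`: the maximum, over all
oriented paths from `(1, 1)` to `(N, M)`, of the sum of the weights along the path.
It is `0` when there is no such path, that is when `N = 0` or `M = 0`. -/
noncomputable def lastPassage (w : ℕ+ × ℕ+ → ℕ) (N M : ℕ) : ℕ :=
  sSup {s : ℕ | ∃ p, IsOrientedPath N M p ∧ s = (p.map w).sum}

/-- `ξ` is a family of i.i.d. random variables with the geometric law
`P(ξ y = k) = (1 - lam) * lam ^ k`, `k = 0, 1, 2, …`. -/
structure IsIIDGeometric {Ω : Type u} [MeasurableSpace Ω] (P : Measure Ω) (lam : ℝ)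
    (ξ : ℕ+ × ℕ+ → Ω → ℕ) : Prop where
  measurable : ∀ y, Measurable (ξ y)
  indep : iIndepFun ξ P
  law : ∀ y k, P.real {ω | ξ y ω = k} = (1 - lam) * lam ^ k

theorem OrientedStep.lt {a b : ℕ+ × ℕ+} (h : OrientedStep a b) : a < b := by
  rcases h with rfl | rfl
  · exact Prod.lt_iff.2 (Or.inl ⟨PNat.lt_add_right _ _, le_rfl⟩)
  · exact Prod.lt_iff.2 (Or.inr ⟨le_rfl, PNat.lt_add_right _ _⟩)

theorem IsOrientedPath.sum_le {N M : ℕ} {p : List (ℕ+ × ℕ+)} (hp : IsOrientedPath N M p)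
    (w : ℕ+ × ℕ+ → ℕ) :
    (p.map w).sum ≤ ∑ y ∈ Finset.Icc (1, 1) (N.toPNat', M.toPNat'), w y := by
  obtain ⟨e, he, h1, h2⟩ := hp.finish
  have hpw : p.Pairwise (· < ·) := List.isChain_iff_pairwise.1 (hp.chain.imp fun _ _ => OrientedStep.lt)
  have hnd : p.Nodup := hpw.imp fun h => h.ne
  have hee : e = (N.toPNat', M.toPNat') := by
    subst h1 h2
    simp
  have hle : ∀ y ∈ p, y ≤ e := by
    intro y hy
    obtain ⟨q, rfl⟩ := List.getLast?_eq_some_iff.1 he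
    rcases List.mem_append.1 hy with h | h
    · exact ((List.pairwise_append.1 hpw).2.2 y h e (by simp)).le
    · simp at h; exact h.le
  rw [← List.sum_toFinset w hnd]
  refine Finset.sum_le_sum_of_subset fun y hy => ?_
  rw [Finset.mem_Icc, ← hee]
  exact ⟨Prod.mk_le_mk.2 ⟨one_le, one_le⟩, hle y (by simpa using hy)⟩

theorem exists_isOrientedPath (a b : ℕ+) : ∃ p, IsOrientedPath a b p := by
  have key : ∀ (c d c' d' : ℕ+), OrientedStep (c, d) (c', d') →
      (∃ p, IsOrientedPath c d p) → ∃ p, IsOrientedPath c' d' p := by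
    rintro c d c' d' hs ⟨p, hc, hst, ⟨e1, e2⟩, he, h1, h2⟩
    obtain rfl : e1 = c := PNat.eq h1
    obtain rfl : e2 = d := PNat.eq h2
    refine ⟨p ++ [(c', d')], ?_, ?_, (c', d'), by simp, rfl, rfl⟩
    · refine List.isChain_append.2 ⟨hc, by simp, ?_⟩
      intro x hx y hy
      simp only [he, Option.mem_def, Option.some.injEq] at hx
      simp at hy
      subst hx hy
      exact hs
    · rw [List.head?_append, hst]; rfl
  induction a using PNat.recOn with
  | one =>
    induction b using PNat.recOn with
    | one => exact ⟨[(1, 1)], by simp, by simp, (1, 1), by simp, rfl, rfl⟩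
    | succ b ih => exact key _ _ _ _ (Or.inr rfl) ih
  | succ a ih => exact key _ _ _ _ (Or.inl rfl) ih

/-- For `N, M ≥ 1`, `lastPassage w N M` is indeed a maximum. -/
theorem lastPassage_isGreatest (w : ℕ+ × ℕ+ → ℕ) {N M : ℕ} (hN : 1 ≤ N) (hM : 1 ≤ M) :
    IsGreatest {s : ℕ | ∃ p, IsOrientedPath N M p ∧ s = (p.map w).sum} (lastPassage w N M) := by
  have hb : BddAbove {s : ℕ | ∃ p, IsOrientedPath N M p ∧ s = (p.map w).sum} :=
    ⟨_, by rintro s ⟨p, hp, rfl⟩; exact hp.sum_le w⟩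
  obtain ⟨p, hp⟩ := exists_isOrientedPath ⟨N, hN⟩ ⟨M, hM⟩
  exact ⟨Nat.sSup_mem ⟨_, p, hp, rfl⟩ hb, fun s hs => le_csSup hb hs⟩

/-! The passage value G with bulk weights only is compared with stationary models, whose passage
value is explicit. Put geometric weights of parameters a on the bottom row and b on the left column,
with ab = λ. By Burke's theorem (`IsGeomField.queueMap`, `IsGeomField.exists_vertIncr`) the
increments along any column are again i.i.d. geometric of parameter b. The passage value is thus a
bottom sum plus a column sum, and Chernoff bounds place it near N f(t), where f(t) = A(t) + βB(t), t
> 0 indexes the pairs (a, b), and A, B are the two boundary means. The function f is least at s =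
√(βλ), and f(s) is the claimed limit.

Upper bound: boundary weights only increase the passage value, so G is at most the value of the
model s.

Lower bound: by `boundaryLPP_exit`, a maximal path of the model s follows the boundary for z sites
and then collects g ≤ G. If z < εN, the boundary part is negligible. If z ≥ εN on the bottom, the
same path is available in a model t > s with the same bulk, so the model s is at most about N f(t) -
z(A(t) - A(s)). For t near s the excess f(t) - f(s) is quadratic in t - s while the gain εN(A(t) -
A(s)) is linear, so this falls below N f(s), a contradiction. The left column is treated likewise
with t < s. All error events are exponentially small, and Borel–Cantelli gives the almost sure
limit. -/

/-- Last passage percolation in the quadrant with boundary weights `h` (bottom) and `v` (left)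
and bulk weights `w`, defined by its recursion. -/
def boundaryLPP (h v : ℕ → ℕ) (w : ℕ × ℕ → ℕ) : ℕ → ℕ → ℕ
  | 0, 0 => 0
  | i + 1, 0 => boundaryLPP h v w i 0 + h i
  | 0, j + 1 => boundaryLPP h v w 0 j + v j
  | i + 1, j + 1 =>
    max (boundaryLPP h v w i (j + 1)) (boundaryLPP h v w (i + 1) j) + w (i, j)

/-! ### The recursion, its increments and the exit point. -/

section Deterministic

variable (h v : ℕ → ℕ) (w : ℕ × ℕ → ℕ)

@[simp] theorem boundaryLPP_zero_zero : boundaryLPP h v w 0 0 = 0 := by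
  rw [boundaryLPP]

theorem boundaryLPP_succ_zero (i : ℕ) :
    boundaryLPP h v w (i + 1) 0 = boundaryLPP h v w i 0 + h i := by
  rw [boundaryLPP]

theorem boundaryLPP_zero_succ (j : ℕ) :
    boundaryLPP h v w 0 (j + 1) = boundaryLPP h v w 0 j + v j := by
  rw [boundaryLPP]

theorem boundaryLPP_succ_succ (i j : ℕ) :
    boundaryLPP h v w (i + 1) (j + 1) =
      max (boundaryLPP h v w i (j + 1)) (boundaryLPP h v w (i + 1) j) + w (i, j) := by
  rw [boundaryLPP]

theorem boundaryLPP_bottom (i : ℕ) :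
    boundaryLPP h v w i 0 = ∑ k ∈ Finset.range i, h k := by
  induction i with
  | zero => simp
  | succ i ih => rw [boundaryLPP_succ_zero, Finset.sum_range_succ, ih]

theorem boundaryLPP_left (j : ℕ) :
    boundaryLPP h v w 0 j = ∑ k ∈ Finset.range j, v k := by
  induction j with
  | zero => simp
  | succ j ih => rw [boundaryLPP_zero_succ, Finset.sum_range_succ, ih]

theorem boundaryLPP_le_succ_left (i j : ℕ) :
    boundaryLPP h v w i j ≤ boundaryLPP h v w (i + 1) j := by
  cases j with
  | zero => rw [boundaryLPP_succ_zero]; omega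
  | succ j => rw [boundaryLPP_succ_succ]; omega

theorem boundaryLPP_le_succ_right (i j : ℕ) :
    boundaryLPP h v w i j ≤ boundaryLPP h v w i (j + 1) := by
  cases i with
  | zero => rw [boundaryLPP_zero_succ]; omega
  | succ i => rw [boundaryLPP_succ_succ]; omega

/-- The vertical increment of `boundaryLPP`. -/
def vertIncr (i j : ℕ) : ℕ := boundaryLPP h v w i (j + 1) - boundaryLPP h v w i j

/-- The horizontal increment of `boundaryLPP`. -/
def horizIncr (i j : ℕ) : ℕ := boundaryLPP h v w (i + 1) j - boundaryLPP h v w i j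

theorem horizIncr_zero (i : ℕ) : horizIncr h v w i 0 = h i := by
  rw [horizIncr, boundaryLPP_succ_zero]; omega

theorem vertIncr_zero (j : ℕ) : vertIncr h v w 0 j = v j := by
  rw [vertIncr, boundaryLPP_zero_succ]; omega

/-- Truncated subtraction supplies the positive part in the Lindley recursion of a queue; this is
what lets the increments be updated site by site by `queueMap`. -/
theorem horizIncr_succ (i j : ℕ) :
    horizIncr h v w i (j + 1) = horizIncr h v w i j - vertIncr h v w i j + w (i, j) := by
  have h1 := boundaryLPP_le_succ_left h v w i j
  have h2 := boundaryLPP_le_succ_right h v w i j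
  rw [horizIncr, horizIncr, vertIncr, boundaryLPP_succ_succ]
  omega

theorem vertIncr_succ (i j : ℕ) :
    vertIncr h v w (i + 1) j = vertIncr h v w i j - horizIncr h v w i j + w (i, j) := by
  have h1 := boundaryLPP_le_succ_left h v w i j
  have h2 := boundaryLPP_le_succ_right h v w i j
  rw [vertIncr, horizIncr, vertIncr, boundaryLPP_succ_succ]
  omega

/-- The value is telescoped along the bottom row and then up column i. In the stationary model each
of the two sums has i.i.d. terms, although they are not independent of each other. -/
theorem boundaryLPP_eq_sum_add_sum_vertIncr (i j : ℕ) :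
    boundaryLPP h v w i j =
      ∑ k ∈ Finset.range i, h k + ∑ k ∈ Finset.range j, vertIncr h v w i k := by
  induction j with
  | zero => simp [boundaryLPP_bottom]
  | succ j ih =>
    have := boundaryLPP_le_succ_right h v w i j
    rw [Finset.sum_range_succ, ← add_assoc, ← ih, vertIncr]
    omega

/-- A maximal path leaves the boundary at some point; the rest of it is available for every
other choice of boundary weights. -/
theorem boundaryLPP_exit (N M : ℕ) :
    (∃ z ≤ N, ∃ g, boundaryLPP h v w N M = ∑ k ∈ Finset.range z, h k + g ∧
      ∀ h' v', ∑ k ∈ Finset.range z, h' k + g ≤ boundaryLPP h' v' w N M) ∨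
    (∃ z ≤ M, ∃ g, boundaryLPP h v w N M = ∑ k ∈ Finset.range z, v k + g ∧
      ∀ h' v', ∑ k ∈ Finset.range z, v' k + g ≤ boundaryLPP h' v' w N M) := by
  induction N generalizing M with
  | zero =>
    exact Or.inr ⟨M, le_rfl, 0, by rw [boundaryLPP_left, add_zero],
      fun h' v' => by rw [boundaryLPP_left, add_zero]⟩
  | succ N ihN =>
    induction M with
    | zero =>
      exact Or.inl ⟨N + 1, le_rfl, 0, by rw [boundaryLPP_bottom, add_zero],
        fun h' v' => by rw [boundaryLPP_bottom, add_zero]⟩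
    | succ M ihM =>
      -- Follow the larger predecessor: its z is kept and g gains the new weight. The bound for
      -- other boundaries persists because their maximum dominates the same predecessor.
      simp only [boundaryLPP_succ_succ]
      rcases le_total (boundaryLPP h v w N (M + 1)) (boundaryLPP h v w (N + 1) M) with hle | hle
      · rw [max_eq_right hle]
        rcases ihM with ⟨z, hz, g, hg, hg'⟩ | ⟨z, hz, g, hg, hg'⟩
        · refine Or.inl ⟨z, hz, g + w (N, M), by omega, fun h' v' => ?_⟩
          have := hg' h' v'
          omega
        · refine Or.inr ⟨z, by omega, g + w (N, M), by omega, fun h' v' => ?_⟩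
          have := hg' h' v'
          omega
      · rw [max_eq_left hle]
        rcases ihN (M + 1) with ⟨z, hz, g, hg, hg'⟩ | ⟨z, hz, g, hg, hg'⟩
        · refine Or.inl ⟨z, by omega, g + w (N, M), by omega, fun h' v' => ?_⟩
          have := hg' h' v'
          omega
        · refine Or.inr ⟨z, hz, g + w (N, M), by omega, fun h' v' => ?_⟩
          have := hg' h' v'
          omega

theorem boundaryLPP_zero_le (N M : ℕ) :
    boundaryLPP 0 0 w N M ≤ boundaryLPP h v w N M := by
  rcases boundaryLPP_exit 0 0 w N M with ⟨z, -, g, hg, hg'⟩ | ⟨z, -, g, hg, hg'⟩ <;>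
  · have := hg' h v
    simp only [Pi.zero_apply, Finset.sum_const_zero] at hg
    omega

end Deterministic

/-! ### Oriented paths and the recursion. -/

/-- The bulk weights in the zero-based indexing of `boundaryLPP`. -/
def shiftWeights (w : ℕ+ × ℕ+ → ℕ) (y : ℕ × ℕ) : ℕ := w (y.1.succPNat, y.2.succPNat)

theorem IsOrientedPath.sum_le_boundaryLPP (w : ℕ+ × ℕ+ → ℕ) {N M : ℕ} {p : List (ℕ+ × ℕ+)}
    (hp : IsOrientedPath N M p) :
    (p.map w).sum ≤ boundaryLPP 0 0 (shiftWeights w) N M := by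
  induction p using List.reverseRecOn generalizing N M with
  | nil => simp at hp ⊢
  | append_singleton q e ih =>
    obtain ⟨e', he, rfl, rfl⟩ := hp.finish
    obtain rfl : e = e' := by simpa using he
    have hw : w e = shiftWeights w ((e.1 : ℕ) - 1, (e.2 : ℕ) - 1) := by
      exact congrArg w (Prod.ext (PNat.succPNat_natPred e.1).symm (PNat.succPNat_natPred e.2).symm)
    obtain ⟨i, hi⟩ : ∃ i, (e.1 : ℕ) = i + 1 := ⟨e.1 - 1, by have := e.1.pos; omega⟩
    obtain ⟨j, hj⟩ : ∃ j, (e.2 : ℕ) = j + 1 := ⟨e.2 - 1, by have := e.2.pos; omega⟩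
    rw [hi, hj] at hw ⊢
    rw [boundaryLPP_succ_succ, List.map_append, List.sum_append]
    simp only [List.map_cons, List.map_nil, List.sum_cons, List.sum_nil, add_zero]
    rw [hw]
    simp only [Nat.add_sub_cancel]
    refine Nat.add_le_add_right ?_ _
    rcases List.eq_nil_or_concat' q with rfl | ⟨q', f, rfl⟩
    · simp
    have hc := List.isChain_append.1 hp.chain
    have hstep : OrientedStep f e := hc.2.2 f (by simp) e (by simp)
    have hq : IsOrientedPath f.1 f.2 (q' ++ [f]) :=
      ⟨hc.1, by have := hp.start; simpa using this, f, by simp, rfl, rfl⟩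
    refine (ih hq).trans ?_
    rcases hstep with rfl | rfl
    · simp only [PNat.add_coe, PNat.one_coe, Nat.add_right_cancel_iff] at hi hj
      rw [hi, hj]; exact le_max_left _ _
    · simp only [PNat.add_coe, PNat.one_coe, Nat.add_right_cancel_iff] at hi hj
      rw [hi, hj]; exact le_max_right _ _

theorem exists_isOrientedPath_sum_eq_boundaryLPP (w : ℕ+ × ℕ+ → ℕ) (i j : ℕ) :
    ∃ p, IsOrientedPath (i + 1) (j + 1) p ∧
      (p.map w).sum = boundaryLPP 0 0 (shiftWeights w) (i + 1) (j + 1) := by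
  have key : ∀ c d c' d' : ℕ, OrientedStep (c.succPNat, d.succPNat) (c'.succPNat, d'.succPNat) →
      (∃ p, IsOrientedPath (c + 1) (d + 1) p ∧
        (p.map w).sum = boundaryLPP 0 0 (shiftWeights w) (c + 1) (d + 1)) →
      ∃ p, IsOrientedPath (c' + 1) (d' + 1) p ∧ (p.map w).sum =
        boundaryLPP 0 0 (shiftWeights w) (c + 1) (d + 1) + shiftWeights w (c', d') := by
    rintro c d c' d' hs ⟨p, ⟨hc, hst, ⟨e1, e2⟩, he, h1, h2⟩, hsum⟩
    obtain rfl : e1 = c.succPNat := PNat.eq h1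
    obtain rfl : e2 = d.succPNat := PNat.eq h2
    refine ⟨p ++ [(c'.succPNat, d'.succPNat)], ⟨?_, ?_, _, List.getLast?_concat, rfl, rfl⟩, ?_⟩
    · refine List.isChain_append.2 ⟨hc, by simp, ?_⟩
      intro x hx y hy
      simp only [he, Option.mem_def, Option.some.injEq] at hx
      simp at hy
      subst hx hy
      exact hs
    · rw [List.head?_append, hst]; rfl
    · rw [List.map_append, List.sum_append, hsum]
      simp [shiftWeights]
  have hl : ∀ c d : ℕ, OrientedStep (c.succPNat, d.succPNat) ((c + 1).succPNat, d.succPNat) :=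
    fun c d => Or.inl rfl
  have hr : ∀ c d : ℕ, OrientedStep (c.succPNat, d.succPNat) (c.succPNat, (d + 1).succPNat) :=
    fun c d => Or.inr rfl
  induction i generalizing j with
  | zero =>
    induction j with
    | zero =>
      refine ⟨[(1, 1)], ⟨by simp, by simp, (1, 1), by simp, rfl, rfl⟩, ?_⟩
      rw [boundaryLPP_succ_succ, boundaryLPP_bottom, boundaryLPP_left]
      simp [shiftWeights]
      rfl
    | succ j ih =>
      obtain ⟨p, hp, hs⟩ := key 0 j 0 (j + 1) (hr _ _) ih
      refine ⟨p, hp, hs.trans ?_⟩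
      rw [boundaryLPP_succ_succ 0 0 _ 0 (j + 1), boundaryLPP_left]
      simp
  | succ i ihi =>
    induction j with
    | zero =>
      obtain ⟨p, hp, hs⟩ := key i 0 (i + 1) 0 (hl _ _) (ihi 0)
      refine ⟨p, hp, hs.trans ?_⟩
      rw [boundaryLPP_succ_succ 0 0 _ (i + 1) 0, boundaryLPP_bottom]
      simp
    | succ j ihj =>
      rw [boundaryLPP_succ_succ 0 0 _ (i + 1) (j + 1)]
      rcases le_total (boundaryLPP 0 0 (shiftWeights w) (i + 1) (j + 1 + 1))
        (boundaryLPP 0 0 (shiftWeights w) (i + 1 + 1) (j + 1)) with hle | hle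
      · rw [max_eq_right hle]; exact key _ _ _ _ (hr _ _) ihj
      · rw [max_eq_left hle]; exact key _ _ _ _ (hl _ _) (ihi (j + 1))

theorem lastPassage_eq_boundaryLPP (w : ℕ+ × ℕ+ → ℕ) (N M : ℕ) :
    lastPassage w N M = boundaryLPP 0 0 (shiftWeights w) N M := by
  rcases N.eq_zero_or_pos with rfl | hN
  -- Without paths the supremum of the empty set is 0, which agrees with the zero boundary sums.
  · have : {s : ℕ | ∃ p, IsOrientedPath 0 M p ∧ s = (p.map w).sum} = ∅ := by
      ext s
      simp only [Set.mem_ofPred_eq, Set.mem_empty_iff_false, iff_false]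
      rintro ⟨p, hp, -⟩
      obtain ⟨e, -, h1, -⟩ := hp.finish
      exact e.1.ne_zero h1
    rw [lastPassage, this, boundaryLPP_left]; simp
  rcases M.eq_zero_or_pos with rfl | hM
  · have : {s : ℕ | ∃ p, IsOrientedPath N 0 p ∧ s = (p.map w).sum} = ∅ := by
      ext s
      simp only [Set.mem_ofPred_eq, Set.mem_empty_iff_false, iff_false]
      rintro ⟨p, hp, -⟩
      obtain ⟨e, -, -, h1⟩ := hp.finish
      exact e.2.ne_zero h1
    rw [lastPassage, this, boundaryLPP_bottom]; simp
  obtain ⟨i, rfl⟩ : ∃ i, N = i + 1 := ⟨N - 1, by omega⟩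
  obtain ⟨j, rfl⟩ : ∃ j, M = j + 1 := ⟨M - 1, by omega⟩
  have hG := lastPassage_isGreatest w hN hM
  refine le_antisymm ?_ ?_
  · obtain ⟨p, hp, hs⟩ := hG.1
    rw [hs]; exact hp.sum_le_boundaryLPP w
  · obtain ⟨p, hp, hs⟩ := exists_isOrientedPath_sum_eq_boundaryLPP w i j
    exact hs ▸ hG.2 ⟨p, hp, rfl⟩

/-! ### Independent geometric fields. -/

/-- The geometric law `k ↦ (1 - p) * p ^ k` on `ℕ`. -/
noncomputable def geomLaw (p : ℝ) : Measure ℕ :=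
  geometricMeasure (Set.projIcc 0 1 zero_le_one (1 - p))

instance isProbabilityMeasure_geomLaw (p : ℝ) : IsProbabilityMeasure (geomLaw p) := by
  unfold geomLaw; infer_instance

theorem geomLaw_singleton {p : ℝ} (hp0 : 0 ≤ p) (hp1 : p < 1) (k : ℕ) :
    geomLaw p {k} = ENNReal.ofReal ((1 - p) * p ^ k) := by
  have h : (Set.projIcc (0 : ℝ) 1 zero_le_one (1 - p)) = ⟨1 - p, by linarith, by linarith⟩ :=
    Set.projIcc_of_mem _ ⟨by linarith, by linarith⟩
  rw [geomLaw, h, geometricMeasure_singleton]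
  · congr 1
    simp only [sub_sub_cancel]; ring
  · intro h0
    have := congrArg Subtype.val h0
    simp only [Set.Icc.coe_zero] at this
    linarith

/-- Independent geometric random variables with parameters `p`. -/
structure IsGeomField {Ω ι : Type*} [MeasurableSpace Ω] (P : Measure Ω) (p : ι → ℝ)
    (ζ : ι → Ω → ℕ) : Prop where
  measurable : ∀ a, Measurable (ζ a)
  indep : iIndepFun ζ P
  law : ∀ a, P.map (ζ a) = geomLaw (p a)

section GeomField

variable {Ω ι κ : Type*} [MeasurableSpace Ω] {P : Measure Ω} {p : ι → ℝ} {ζ : ι → Ω → ℕ}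

theorem IsGeomField.precomp (h : IsGeomField P p ζ) {f : κ → ι} (hf : f.Injective) :
    IsGeomField P (fun a => p (f a)) (fun a => ζ (f a)) :=
  ⟨fun _ => h.measurable _, h.indep.precomp hf, fun _ => h.law _⟩

theorem IsGeomField.map_eq (h : IsGeomField P p ζ) [IsProbabilityMeasure P] :
    P.map (fun ω a => ζ a ω) = Measure.infinitePi (fun a => geomLaw (p a)) := by
  rw [h.indep.map_fun_eq_infinitePi_map h.measurable]
  simp_rw [h.law]

theorem isGeomField_infinitePi (p : ι → ℝ) :
    IsGeomField (Measure.infinitePi fun a => geomLaw (p a)) p (fun a ω => ω a) :=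
  ⟨fun a => measurable_pi_apply a, iIndepFun_infinitePi (X := fun _ x => x) fun _ => measurable_id,
    fun a => Measure.infinitePi_map_eval _ a⟩

theorem IsGeomField.measure_eq [Fintype ι] (h : IsGeomField P p ζ) (x : ι → ℕ) :
    P {ω | ∀ i, ζ i ω = x i} = ∏ i, geomLaw (p i) {x i} := by
  have := h.indep.measure_inter_preimage_eq_mul Finset.univ (sets := fun i => {x i})
    (fun i _ => measurableSet_singleton _)
  simp only [Finset.mem_univ, Set.iInter_true] at this
  calc _ = P (⋂ i, ζ i ⁻¹' {x i}) := by congr 1; ext; simp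
    _ = _ := by
      rw [this]
      refine Finset.prod_congr rfl fun i _ => ?_
      rw [← h.law, Measure.map_apply (h.measurable i) (measurableSet_singleton _)]

theorem isGeomField_of_measure_eq [Fintype ι] [IsProbabilityMeasure P]
    (hm : ∀ i, Measurable (ζ i))
    (h : ∀ x : ι → ℕ, P {ω | ∀ i, ζ i ω = x i} = ∏ i, geomLaw (p i) {x i}) :
    IsGeomField P p ζ := by
  have hm' : Measurable fun ω i => ζ i ω := measurable_pi_iff.2 hm
  have hmap : P.map (fun ω i => ζ i ω) = Measure.pi fun i => geomLaw (p i) := by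
    refine Measure.ext_of_singleton fun x => ?_
    rw [Measure.pi_singleton, ← h, Measure.map_apply hm' (measurableSet_singleton _)]
    congr 1; ext ω; simp [funext_iff]
  have hlaw : ∀ i, P.map (ζ i) = geomLaw (p i) := fun i => by
    rw [← (measurePreserving_eval (fun i => geomLaw (p i)) i).map_eq, ← hmap,
      Measure.map_map (measurable_pi_apply i) hm']
    rfl
  refine ⟨hm, ?_, hlaw⟩
  rw [iIndepFun_iff_map_fun_eq_pi_map fun i => (hm i).aemeasurable, hmap]
  simp_rw [hlaw]

/-- Independence is a condition on finite subfamilies, and any of these may be enlarged to contain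
`t`. For `queueMap`, `t` consists of the three altered coordinates, so only finite sets stable under
the map are met. -/
theorem isGeomField_of_finset [IsProbabilityMeasure P] [DecidableEq ι] (t : Finset ι)
    (h : ∀ s : Finset ι, t ⊆ s → IsGeomField P (fun i : s => p i) (fun i : s => ζ i)) :
    IsGeomField P p ζ := by
  refine ⟨fun a => ?_, ?_, fun a => ?_⟩
  · exact (h (insert a t) (Finset.subset_insert _ _)).measurable
      ⟨a, Finset.mem_insert_self _ _⟩
  · refine iIndepFun_iff_finset.2 fun s => ?_
    exact (h (s ∪ t) Finset.subset_union_right).indep.precomp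
      (g := fun i : s => ⟨i, Finset.mem_union_left _ i.2⟩)
      (fun i j hij => Subtype.ext (Subtype.mk.inj hij))
  · exact (h (insert a t) (Finset.subset_insert _ _)).law ⟨a, Finset.mem_insert_self _ _⟩

end GeomField

/-! ### Burke's theorem at one site. -/

section Burke

variable {ι : Type*} [DecidableEq ι]

/-- The queueing map: `(x a, x b, x c)` is the triple (horizontal increment, vertical increment,
bulk weight) of a site; after it come the two outgoing increments and the dual weight. -/
def queueMap (a b c : ι) (x : ι → ℕ) (i : ι) : ℕ :=
  if i = a then x a - x b + x c
  else if i = b then x b - x a + x c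
  else if i = c then min (x a) (x b) else x i

variable {a b c : ι}

theorem queueMap_left (x : ι → ℕ) : queueMap a b c x a = x a - x b + x c := by
  simp [queueMap]

theorem queueMap_mid (hab : a ≠ b) (x : ι → ℕ) : queueMap a b c x b = x b - x a + x c := by
  simp [queueMap, hab.symm]

theorem queueMap_right (hac : a ≠ c) (hbc : b ≠ c) (x : ι → ℕ) :
    queueMap a b c x c = min (x a) (x b) := by
  simp [queueMap, hac.symm, hbc.symm]

theorem queueMap_of_ne {i : ι} (ha : i ≠ a) (hb : i ≠ b) (hc : i ≠ c) (x : ι → ℕ) :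
    queueMap a b c x i = x i := by
  simp [queueMap, ha, hb, hc]

/-- Being an involution, the map pulls a point event back to a point event, so its effect on the law
is read off from point masses. -/
theorem queueMap_queueMap (hab : a ≠ b) (hac : a ≠ c) (hbc : b ≠ c) (x : ι → ℕ) :
    queueMap a b c (queueMap a b c x) = x := by
  funext i
  by_cases ha : i = a
  · subst ha
    rw [queueMap_left, queueMap_left, queueMap_mid hab, queueMap_right hac hbc]; omega
  by_cases hb : i = b
  · subst hb
    rw [queueMap_mid hab, queueMap_left, queueMap_mid hab, queueMap_right hac hbc]; omega
  by_cases hc : i = c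
  · subst hc
    rw [queueMap_right hac hbc, queueMap_left, queueMap_mid hab]; omega
  rw [queueMap_of_ne ha hb hc, queueMap_of_ne ha hb hc]

theorem queueMap_eq_on {s : Finset ι} (ha : a ∈ s) (hb : b ∈ s) (hc : c ∈ s) {x y : ι → ℕ}
    (h : ∀ i ∈ s, x i = y i) : ∀ i ∈ s, queueMap a b c x i = queueMap a b c y i := by
  intro i hi
  simp only [queueMap, h a ha, h b hb, h c hc, h i hi]

/-- Since u = (u - v)⁺ + min(u, v) and the third parameter is the product of the first two, the
total exponents of `p a` and `p b` are `x a + x c` and `x b + x c` on both sides. -/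
theorem prod_geomLaw_queueMap (hab : a ≠ b) (hac : a ≠ c) (hbc : b ≠ c) {p : ι → ℝ}
    (ha0 : 0 ≤ p a) (ha1 : p a < 1) (hb0 : 0 ≤ p b) (hb1 : p b < 1) (hc : p c = p a * p b)
    {s : Finset ι} (has : a ∈ s) (hbs : b ∈ s) (hcs : c ∈ s) (x : ι → ℕ) :
    ∏ i ∈ s, geomLaw (p i) {queueMap a b c x i} = ∏ i ∈ s, geomLaw (p i) {x i} := by
  have hsub : ({a, b, c} : Finset ι) ⊆ s := by
    intro i hi
    simp only [Finset.mem_insert, Finset.mem_singleton] at hi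
    rcases hi with rfl | rfl | rfl <;> assumption
  rw [← Finset.prod_sdiff hsub, ← Finset.prod_sdiff (f := fun i => geomLaw (p i) {x i}) hsub]
  congr 1
  · refine Finset.prod_congr rfl fun i hi => ?_
    simp only [Finset.mem_sdiff, Finset.mem_insert, Finset.mem_singleton, not_or] at hi
    rw [queueMap_of_ne hi.2.1 hi.2.2.1 hi.2.2.2]
  · have hc0 : 0 ≤ p c := hc ▸ mul_nonneg ha0 hb0
    have hc1 : p c < 1 := by rw [hc]; nlinarith
    rw [Finset.prod_insert (by simp [hab, hac]), Finset.prod_insert (by simp [hbc]),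
      Finset.prod_singleton, Finset.prod_insert (by simp [hab, hac]),
      Finset.prod_insert (by simp [hbc]), Finset.prod_singleton, queueMap_left, queueMap_mid hab,
      queueMap_right hac hbc]
    have ha2 : ∀ k, 0 ≤ (1 - p a) * p a ^ k := fun k => mul_nonneg (by linarith) (pow_nonneg ha0 _)
    have hb2 : ∀ k, 0 ≤ (1 - p b) * p b ^ k := fun k => mul_nonneg (by linarith) (pow_nonneg hb0 _)
    simp only [geomLaw_singleton ha0 ha1, geomLaw_singleton hb0 hb1, geomLaw_singleton hc0 hc1]
    rw [← ENNReal.ofReal_mul (hb2 _), ← ENNReal.ofReal_mul (ha2 _),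
      ← ENNReal.ofReal_mul (hb2 _), ← ENNReal.ofReal_mul (ha2 _)]
    congr 1
    rw [hc]
    rcases le_total (x a) (x b) with h | h
    · obtain ⟨d, hd⟩ := Nat.exists_eq_add_of_le h
      rw [min_eq_left h, hd]
      simp only [Nat.sub_self_add, Nat.add_sub_cancel_left]
      ring
    · obtain ⟨d, hd⟩ := Nat.exists_eq_add_of_le h
      rw [min_eq_right h, hd]
      simp only [Nat.sub_self_add, Nat.add_sub_cancel_left]
      ring

/-- Burke's theorem for one site. -/
theorem IsGeomField.queueMap {Ω : Type*} [MeasurableSpace Ω] {P : Measure Ω}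
    [IsProbabilityMeasure P] {p : ι → ℝ} {ζ : ι → Ω → ℕ} (h : IsGeomField P p ζ)
    (hab : a ≠ b) (hac : a ≠ c) (hbc : b ≠ c)
    (ha0 : 0 ≤ p a) (ha1 : p a < 1) (hb0 : 0 ≤ p b) (hb1 : p b < 1) (hc : p c = p a * p b) :
    IsGeomField P p (fun i ω => queueMap a b c (fun k => ζ k ω) i) := by
  refine isGeomField_of_finset {a, b, c} fun s hs => ?_
  have has : a ∈ s := hs (by simp)
  have hbs : b ∈ s := hs (by simp)
  have hcs : c ∈ s := hs (by simp)
  refine isGeomField_of_measure_eq (fun i => ?_) fun x => ?_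
  · have hma := h.measurable a
    have hmb := h.measurable b
    have hmc := h.measurable c
    have hmi := h.measurable i
    unfold _root_.queueMap
    split_ifs <;> fun_prop
  -- The extension by 0 is harmless: `s` contains a, b and c, so values outside `s` never enter.
  · set y : ι → ℕ := fun i => if hi : i ∈ s then x ⟨i, hi⟩ else 0 with hy
    have hyx : ∀ i : s, y i = x i := fun i => by simp [hy]
    have hset : {ω | ∀ i : s, _root_.queueMap a b c (fun k => ζ k ω) i = x i} =
        {ω | ∀ i : s, ζ i ω = _root_.queueMap a b c y i} := by
      ext ω
      simp only [Set.mem_ofPred_eq, ← hyx, Subtype.forall]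
      constructor
      · intro h1 i hi
        rw [← queueMap_eq_on has hbs hcs h1 i hi, queueMap_queueMap hab hac hbc]
      · intro h1 i hi
        rw [queueMap_eq_on has hbs hcs h1 i hi, queueMap_queueMap hab hac hbc]
    rw [hset]
    have := (h.precomp (f := ((↑) : s → ι)) Subtype.val_injective).measure_eq
      (fun i => _root_.queueMap a b c y i)
    rw [this, Finset.prod_coe_sort s (fun i => geomLaw (p i) {_root_.queueMap a b c y i}),
      prod_geomLaw_queueMap hab hac hbc ha0 ha1 hb0 hb1 hc has hbs hcs,
      ← Finset.prod_coe_sort s (fun i => geomLaw (p i) {y i})]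
    simp_rw [hyx]

end Burke

/-! ### Burke's theorem along a column. -/

section Sweep

variable {Ω : Type*} [MeasurableSpace Ω] {P : Measure Ω} [IsProbabilityMeasure P]

/-- The parameters of the stationary model: `a` on the bottom, `b` on the left,
`a * b` in the bulk. -/
def stationaryParam (a b : ℝ) : ℕ ⊕ ℕ ⊕ (ℕ × ℕ) → ℝ :=
  Sum.elim (fun _ => a) (Sum.elim (fun _ => b) (fun _ => a * b))

/-- The vertical increments of the stationary model along a column are again independent and
geometric. -/
theorem IsGeomField.exists_vertIncr {a b : ℝ} (ha0 : 0 ≤ a) (ha1 : a < 1) (hb0 : 0 ≤ b)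
    (hb1 : b < 1) {ζ : ℕ ⊕ ℕ ⊕ (ℕ × ℕ) → Ω → ℕ} (h : IsGeomField P (stationaryParam a b) ζ)
    (N M : ℕ) :
    ∃ X : ℕ → Ω → ℕ, IsGeomField P (fun _ => b) X ∧ ∀ l < M, ∀ ω, X l ω =
      vertIncr (fun k => ζ (.inl k) ω) (fun k => ζ (.inr (.inl k)) ω)
        (fun y => ζ (.inr (.inr y)) ω) N l := by
  set V : ℕ → ℕ → Ω → ℕ := fun i l ω => vertIncr (fun k => ζ (.inl k) ω)
    (fun k => ζ (.inr (.inl k)) ω) (fun y => ζ (.inr (.inr y)) ω) i l with hV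
  set H : ℕ → ℕ → Ω → ℕ := fun i l ω => horizIncr (fun k => ζ (.inl k) ω)
    (fun k => ζ (.inr (.inl k)) ω) (fun y => ζ (.inr (.inr y)) ω) i l with hH
  -- Sweep invariant. Columns are processed from left to right, each upwards. After j sites of
  -- column i, the left slots below j hold increments of column i + 1, those from j to M - 1 still
  -- hold column i, bottom slot i holds the current horizontal increment, and unvisited sites keep
  -- their weights. Each site is one application of `IsGeomField.queueMap`.
  have key : ∀ i j, j ≤ M → ∃ ζ' : ℕ ⊕ ℕ ⊕ (ℕ × ℕ) → Ω → ℕ,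
      IsGeomField P (stationaryParam a b) ζ' ∧
      (∀ l < j, ζ' (.inr (.inl l)) = V (i + 1) l) ∧
      (∀ l, j ≤ l → l < M → ζ' (.inr (.inl l)) = V i l) ∧
      ζ' (.inl i) = H i j ∧ (∀ k, i < k → ζ' (.inl k) = ζ (.inl k)) ∧
      (∀ l, j ≤ l → ζ' (.inr (.inr (i, l))) = ζ (.inr (.inr (i, l)))) ∧
      (∀ k, i < k → ∀ l, ζ' (.inr (.inr (k, l))) = ζ (.inr (.inr (k, l)))) := by
    have step : ∀ i, (∃ ζ' : ℕ ⊕ ℕ ⊕ (ℕ × ℕ) → Ω → ℕ,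
        IsGeomField P (stationaryParam a b) ζ' ∧
        (∀ l < M, ζ' (.inr (.inl l)) = V i l) ∧
        (∀ k, i ≤ k → ζ' (.inl k) = ζ (.inl k)) ∧
        (∀ k, i ≤ k → ∀ l, ζ' (.inr (.inr (k, l))) = ζ (.inr (.inr (k, l))))) →
        ∀ j, j ≤ M → ∃ ζ' : ℕ ⊕ ℕ ⊕ (ℕ × ℕ) → Ω → ℕ,
        IsGeomField P (stationaryParam a b) ζ' ∧
        (∀ l < j, ζ' (.inr (.inl l)) = V (i + 1) l) ∧
        (∀ l, j ≤ l → l < M → ζ' (.inr (.inl l)) = V i l) ∧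
        ζ' (.inl i) = H i j ∧ (∀ k, i < k → ζ' (.inl k) = ζ (.inl k)) ∧
        (∀ l, j ≤ l → ζ' (.inr (.inr (i, l))) = ζ (.inr (.inr (i, l)))) ∧
        (∀ k, i < k → ∀ l, ζ' (.inr (.inr (k, l))) = ζ (.inr (.inr (k, l)))) := by
      rintro i ⟨ζ₀, hf, hv, hh, hw⟩ j
      induction j with
      | zero =>
        intro _
        refine ⟨ζ₀, hf, fun l hl => absurd hl (by omega), fun l _ hl => hv l hl, ?_,
          fun k hk => hh k hk.le, fun l _ => hw i le_rfl l, fun k hk l => hw k hk.le l⟩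
        rw [hh i le_rfl]
        funext ω
        simp only [hH, horizIncr_zero]
      | succ j ih =>
        intro hj
        obtain ⟨ζ₁, hf, h1, h2, h3, h4, h5, h6⟩ := ih (by omega)
        refine ⟨_, hf.queueMap (p := stationaryParam a b) (a := (Sum.inl i : ℕ ⊕ ℕ ⊕ (ℕ × ℕ)))
          (b := .inr (.inl j)) (c := .inr (.inr (i, j))) (by simp) (by simp) (by simp)
          ha0 ha1 hb0 hb1 rfl, ?_, ?_, ?_, ?_, ?_, ?_⟩
        · intro l hl
          funext ω
          rcases eq_or_ne l j with rfl | hlj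
          · rw [queueMap_mid (by simp), h3, h2 l le_rfl (by omega), h5 l le_rfl]
            simp only [hV, hH, vertIncr_succ]
          · rw [queueMap_of_ne (by simp) (by simpa using hlj) (by simp), h1 l (by omega)]
        · intro l hl hlM
          funext ω
          rw [queueMap_of_ne (by simp) (by simp; omega) (by simp), h2 l (by omega) hlM]
        · funext ω
          rw [queueMap_left, h3, h2 j le_rfl (by omega), h5 j le_rfl]
          simp only [hV, hH, horizIncr_succ]
        · intro k hk
          funext ω
          rw [queueMap_of_ne (by simp; omega) (by simp) (by simp), h4 k hk]
        · intro l hl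
          funext ω
          rw [queueMap_of_ne (by simp) (by simp) (by simp; omega), h5 l (by omega)]
        · intro k hk l
          funext ω
          rw [queueMap_of_ne (by simp) (by simp) (by simp; omega), h6 k hk l]
    intro i
    induction i with
    | zero =>
      refine step 0 ⟨ζ, h, fun l _ => ?_, fun _ _ => rfl, fun _ _ _ => rfl⟩
      funext ω
      simp only [hV, vertIncr_zero]
    | succ i ih =>
      obtain ⟨ζ₁, hf, h1, -, -, h4, -, h6⟩ := ih M le_rfl
      exact step (i + 1) ⟨ζ₁, hf, h1, fun k hk => h4 k hk, fun k hk => h6 k hk⟩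
  obtain ⟨ζ', hf, -, h2, -⟩ := key N 0 (Nat.zero_le _)
  refine ⟨fun l => ζ' (.inr (.inl l)), hf.precomp (f := fun l : ℕ => .inr (.inl l)) ?_, ?_⟩
  · intro x y hxy; simpa using hxy
  · intro l hl ω
    simp only [h2 l (Nat.zero_le _) hl, hV]

end Sweep

/-! ### Chernoff bounds. -/

theorem integrable_exp_geomLaw {p : ℝ} (hp0 : 0 ≤ p) (hp1 : p < 1) {t : ℝ}
    (ht : p * Real.exp t < 1) : Integrable (fun k : ℕ => Real.exp (t * k)) (geomLaw p) ∧
      mgf (fun k : ℕ => (k : ℝ)) (geomLaw p) t = (1 - p) / (1 - p * Real.exp t) := by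
  have h : (Set.projIcc (0 : ℝ) 1 zero_le_one (1 - p)) = ⟨1 - p, by linarith, by linarith⟩ :=
    Set.projIcc_of_mem _ ⟨by linarith, by linarith⟩
  have hne : (⟨1 - p, by linarith, by linarith⟩ : unitInterval) ≠ 0 := by
    intro h0
    have := congrArg Subtype.val h0
    simp only [Set.Icc.coe_zero] at this
    linarith
  have hs := (hasSum_geometric_of_lt_one (mul_nonneg hp0 (Real.exp_pos t).le) ht).mul_left (1 - p)
  have hterm : ∀ k : ℕ, (1 - (1 - p)) ^ k * (1 - p) * Real.exp (t * k) =
      (1 - p) * (p * Real.exp t) ^ k := fun k => by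
    rw [mul_comm t, Real.exp_nat_mul, mul_pow]; ring
  constructor
  · rw [geomLaw, h, integrable_geometricMeasure_iff hne]
    simp only [Real.norm_eq_abs, Real.abs_exp, hterm]
    exact hs.summable
  · rw [mgf, geomLaw, h, integral_geometricMeasure hne]
    simp only [smul_eq_mul, hterm]
    rw [hs.tsum_eq, div_eq_mul_inv]

/-- The derivative of the moment generating function at 0 is the mean, and 1 + x ≤ exp x. The linear
slack η|t| suffices for deviations of order N. -/
theorem exists_forall_mgf_geomLaw_le {p : ℝ} (hp1 : p < 1) {η : ℝ} (hη : 0 < η) :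
    ∃ τ > 0, ∀ t : ℝ, |t| ≤ τ → p * Real.exp t < 1 ∧
      (1 - p) / (1 - p * Real.exp t) ≤ Real.exp (t * (p / (1 - p)) + η * |t|) := by
  have hp : 1 - p ≠ 0 := by linarith
  have hd : HasDerivAt (fun t : ℝ => (1 - p) / (1 - p * Real.exp t)) (p / (1 - p)) 0 := by
    have h1 : HasDerivAt (fun t : ℝ => 1 - p * Real.exp t) (-(p * Real.exp 0)) 0 :=
      ((Real.hasDerivAt_exp 0).const_mul p).const_sub 1
    have h2 := (hasDerivAt_const (0 : ℝ) (1 - p)).div h1 (by simpa using hp)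
    refine h2.congr_deriv ?_
    simp only [Real.exp_zero, mul_one]
    field_simp
    ring
  have hlt : ∀ᶠ t in 𝓝 (0 : ℝ), p * Real.exp t < 1 := by
    have hc : ContinuousAt (fun t : ℝ => p * Real.exp t) 0 := by fun_prop
    exact hc.eventually_lt continuousAt_const (by simpa using hp1)
  have ho := hd.isLittleO.def hη
  obtain ⟨τ, hτ, hb⟩ := Metric.eventually_nhds_iff_ball.1 (hlt.and ho)
  refine ⟨τ / 2, by positivity, fun t ht => ?_⟩
  obtain ⟨h1, h2⟩ := hb t (by rw [Metric.mem_ball, Real.dist_eq, sub_zero]; linarith)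
  refine ⟨h1, ?_⟩
  simp only [Real.exp_zero, mul_one, sub_zero, div_self hp, smul_eq_mul, Real.norm_eq_abs] at h2
  have h3 := (abs_le.1 h2).2
  have h4 := Real.add_one_le_exp (t * (p / (1 - p)) + η * |t|)
  linarith

/-- Uniform Chernoff bound for sums of independent geometric random variables. -/
theorem exists_chernoff_geom {Ω : Type*} [MeasurableSpace Ω] (P : Measure Ω)
    [IsProbabilityMeasure P] {p : ℝ} (hp0 : 0 ≤ p) (hp1 : p < 1) {K ε : ℝ} (hK : 0 < K)
    (hε : 0 < ε) :
    ∃ c > 0, ∀ X : ℕ → Ω → ℕ, IsGeomField P (fun _ => p) X → ∀ (N : ℝ) (n : ℕ), n ≤ K * N →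
      P.real {ω | ε * N < |((∑ i ∈ Finset.range n, X i ω : ℕ) : ℝ) - n * (p / (1 - p))|} ≤
        2 * Real.exp (-c * N) := by
  -- With n ≤ KN this slack costs at most half of the exponent τεN.
  obtain ⟨τ, hτ, hb⟩ := exists_forall_mgf_geomLaw_le hp1 (η := ε / (2 * K)) (by positivity)
  refine ⟨τ * ε / 2, by positivity, fun X hX N n hn => ?_⟩
  set m := p / (1 - p) with hm
  set Y : ℕ → Ω → ℝ := fun i ω => (X i ω : ℝ) with hY
  have hYm : ∀ i, Measurable (Y i) := fun i => measurable_from_top.comp (hX.measurable i)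
  have hYi : iIndepFun Y P :=
    hX.indep.comp (fun _ (k : ℕ) => (k : ℝ)) fun _ => measurable_from_top
  have hmgf : ∀ t, |t| ≤ τ → Integrable (fun ω => Real.exp (t * (∑ i ∈ Finset.range n, Y i) ω)) P ∧
      mgf (∑ i ∈ Finset.range n, Y i) P t ≤ Real.exp (n * (t * m + ε / (2 * K) * |t|)) := by
    intro t ht
    obtain ⟨h1, h2⟩ := hb t ht
    have hi := integrable_exp_geomLaw hp0 hp1 h1
    have hYint : ∀ i, Integrable (fun ω => Real.exp (t * Y i ω)) P := fun i => by
      have := hi.1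
      rw [← hX.law i] at this
      exact this.comp_measurable (hX.measurable i)
    have hYmgf : ∀ i, mgf (Y i) P t = (1 - p) / (1 - p * Real.exp t) := fun i => by
      rw [← hi.2, ← hX.law i, mgf_map (hX.measurable i).aemeasurable
        (measurable_from_top.aestronglyMeasurable)]
      rfl
    refine ⟨hYi.integrable_exp_mul_sum hYm fun i _ => hYint i, ?_⟩
    rw [hYi.mgf_sum hYm, Finset.prod_congr rfl fun i _ => hYmgf i, Finset.prod_const,
      Finset.card_range, Real.exp_nat_mul]
    refine pow_le_pow_left₀ ?_ h2 n
    exact div_nonneg (by linarith) (by linarith)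
  have hn2 : (n : ℝ) * (ε / (2 * K)) ≤ ε * N / 2 := by
    calc (n : ℝ) * (ε / (2 * K)) ≤ K * N * (ε / (2 * K)) := by gcongr
      _ = _ := by field_simp
  have hup : P.real {ω | n * m + ε * N ≤ (∑ i ∈ Finset.range n, Y i) ω} ≤
      Real.exp (-(τ * ε / 2) * N) := by
    obtain ⟨h1, h2⟩ := hmgf τ (abs_of_pos hτ).le
    refine (measure_ge_le_exp_mul_mgf _ hτ.le h1).trans ?_
    refine (mul_le_mul_of_nonneg_left h2 (Real.exp_pos _).le).trans ?_
    rw [← Real.exp_add, Real.exp_le_exp, abs_of_pos hτ]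
    nlinarith
  have hlow : P.real {ω | (∑ i ∈ Finset.range n, Y i) ω ≤ n * m - ε * N} ≤
      Real.exp (-(τ * ε / 2) * N) := by
    obtain ⟨h1, h2⟩ := hmgf (-τ) (by rw [abs_neg, abs_of_pos hτ])
    refine (measure_le_le_exp_mul_mgf _ (by linarith) h1).trans ?_
    refine (mul_le_mul_of_nonneg_left h2 (Real.exp_pos _).le).trans ?_
    rw [← Real.exp_add, Real.exp_le_exp, abs_neg, abs_of_pos hτ]
    nlinarith
  calc _ ≤ P.real ({ω | n * m + ε * N ≤ (∑ i ∈ Finset.range n, Y i) ω} ∪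
        {ω | (∑ i ∈ Finset.range n, Y i) ω ≤ n * m - ε * N}) := by
        refine measureReal_mono fun ω hω => ?_
        simp only [Set.mem_ofPred_eq, Set.mem_union, Finset.sum_apply, hY, Nat.cast_sum] at hω ⊢
        rcases lt_abs.1 hω with h | h
        · left; linarith
        · right; linarith
    _ ≤ _ := measureReal_union_le _ _
    _ ≤ _ := by linarith

/-! ### Exponentially small events. -/

/-- Events whose probabilities are exponentially small. -/
def ExpSmall {Ω : Type*} [MeasurableSpace Ω] (P : Measure Ω) (E : ℕ → Set Ω) : Prop :=
  ∃ c > 0, ∃ C > 0, ∀ N : ℕ, 1 ≤ N → P.real (E N) ≤ C * Real.exp (-c * N)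

section ExpSmall

variable {Ω : Type*} [MeasurableSpace Ω] {P : Measure Ω} {E F : ℕ → Set Ω}

theorem ExpSmall.union (hE : ExpSmall P E) (hF : ExpSmall P F) :
    ExpSmall P fun N => E N ∪ F N := by
  obtain ⟨c, hc, C, hC, h⟩ := hE
  obtain ⟨d, hd, D, hD, h'⟩ := hF
  refine ⟨min c d, lt_min hc hd, C + D, by positivity, fun N hN => ?_⟩
  calc P.real (E N ∪ F N) ≤ P.real (E N) + P.real (F N) := measureReal_union_le _ _
    _ ≤ C * Real.exp (-c * N) + D * Real.exp (-d * N) := add_le_add (h N hN) (h' N hN)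
    _ ≤ C * Real.exp (-min c d * N) + D * Real.exp (-min c d * N) := by
      gcongr
      · exact min_le_left _ _
      · exact min_le_right _ _
    _ = _ := by ring

/-- The union bound costs a factor linear in N, absorbed by halving the rate. -/
theorem expSmall_biUnion {A : ℕ → ℕ → Set Ω} {c D K : ℝ} (hc : 0 < c) (hD : 0 < D)
    (hK : 0 < K)
    (h : ∀ N n : ℕ, 1 ≤ N → n ≤ K * N → P.real (A N n) ≤ D * Real.exp (-c * N)) :
    ExpSmall P fun N => {ω | ∃ n : ℕ, n ≤ K * N ∧ ω ∈ A N n} := by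
  refine ⟨c / 2, by positivity, D * (K * (2 / c) + 1), by positivity, fun N hN => ?_⟩
  have hKN : 0 ≤ K * N := by positivity
  have hset : {ω | ∃ n : ℕ, n ≤ K * N ∧ ω ∈ A N n} =
      ⋃ n ∈ Finset.range (⌊K * N⌋₊ + 1), A N n := by
    ext ω
    simp [Nat.le_floor_iff hKN]
  calc P.real {ω | ∃ n : ℕ, n ≤ K * N ∧ ω ∈ A N n}
      = P.real (⋃ n ∈ Finset.range (⌊K * N⌋₊ + 1), A N n) := by rw [hset]
    _ ≤ ∑ n ∈ Finset.range (⌊K * N⌋₊ + 1), P.real (A N n) := measureReal_biUnion_finset_le _ _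
    _ ≤ ∑ n ∈ Finset.range (⌊K * N⌋₊ + 1), D * Real.exp (-c * N) := by
      refine Finset.sum_le_sum fun n hn => h N n hN ?_
      rw [Finset.mem_range, Nat.lt_succ_iff, Nat.le_floor_iff hKN] at hn
      exact hn
    _ = (⌊K * N⌋₊ + 1) * (D * Real.exp (-c * N)) := by simp
    _ ≤ (K * N + 1) * (D * Real.exp (-c * N)) := by
      gcongr; exact Nat.floor_le hKN
    _ = (K * (2 / c) * (c / 2 * N) + 1) * (D * Real.exp (-c * N)) := by field_simp
    _ ≤ (K * (2 / c) * Real.exp (c / 2 * N) + 1 * Real.exp (c / 2 * N)) *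
        (D * Real.exp (-c * N)) := by
      gcongr
      · linarith [Real.add_one_le_exp (c / 2 * (N : ℝ))]
      · rw [one_mul]; exact Real.one_le_exp (by positivity)
    _ = D * (K * (2 / c) + 1) * (Real.exp (c / 2 * N) * Real.exp (-c * N)) := by ring
    _ = _ := by rw [← Real.exp_add]; congr 2; ring

variable [IsProbabilityMeasure P]

/-- Probabilities are at most 1, so the indices below `N₀` are covered by enlarging the constant. -/
theorem ExpSmall.of_eventually_subset {N₀ : ℕ} (hE : ExpSmall P E)
    (h : ∀ N, N₀ ≤ N → 1 ≤ N → F N ⊆ E N) : ExpSmall P F := by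
  obtain ⟨c, hc, C, hC, hE⟩ := hE
  refine ⟨c, hc, C + Real.exp (c * N₀), by positivity, fun N hN => ?_⟩
  rcases le_or_gt N₀ N with hN0 | hN0
  · calc P.real (F N) ≤ P.real (E N) := measureReal_mono (h N hN0 hN)
      _ ≤ C * Real.exp (-c * N) := hE N hN
      _ ≤ _ := by gcongr; linarith [Real.exp_pos (c * N₀)]
  · calc P.real (F N) ≤ 1 := measureReal_le_one
      _ ≤ Real.exp (c * N₀) * Real.exp (-c * N) := by
        rw [← Real.exp_add]
        apply Real.one_le_exp
        have : (N : ℝ) ≤ N₀ := by exact_mod_cast hN0.le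
        nlinarith
      _ ≤ _ := by gcongr; linarith

theorem ExpSmall.ae_eventually_notMem (hE : ExpSmall P E) :
    ∀ᵐ ω ∂P, ∀ᶠ N in atTop, ω ∉ E N := by
  obtain ⟨c, hc, C, hC, h⟩ := hE
  have hs : Summable fun N => P.real (E N) := by
    have h1 : Summable fun N : ℕ => C * Real.exp (-c) ^ N :=
      (summable_geometric_of_lt_one (Real.exp_pos _).le (by simpa using hc)).mul_left C
    rw [← summable_nat_add_iff 1] at h1 ⊢
    refine h1.of_nonneg_of_le (fun _ => measureReal_nonneg) fun N => ?_
    rw [← Real.exp_nat_mul, mul_comm _ (-c)]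
    exact h (N + 1) (by omega)
  refine MeasureTheory.ae_eventually_notMem ?_
  have : ∀ N, P (E N) = ENNReal.ofReal (P.real (E N)) := fun N => by
    rw [ofReal_measureReal]
  simp_rw [this]
  exact hs.tsum_ofReal_ne_top

end ExpSmall

/-! ### The stationary family and its optimal index. -/

/-- The stationary bottom parameter with index `t > 0`. -/
noncomputable def bottomParam (lam t : ℝ) : ℝ := (t + lam) / (1 + t)

/-- The stationary left parameter with index `t > 0`. -/
noncomputable def leftParam (lam t : ℝ) : ℝ := lam * (1 + t) / (t + lam)

/-- The mean of the geometric law with parameter `bottomParam lam t`. -/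
noncomputable def bottomMean (lam t : ℝ) : ℝ := (t + lam) / (1 - lam)

/-- The mean of the geometric law with parameter `leftParam lam t`. -/
noncomputable def leftMean (lam t : ℝ) : ℝ := lam * (1 + t) / ((1 - lam) * t)

section Parameters

variable {lam t : ℝ}

theorem bottomParam_mul_leftParam (h0 : 0 < lam) (ht : 0 < t) :
    bottomParam lam t * leftParam lam t = lam := by
  unfold bottomParam leftParam; field_simp

theorem bottomParam_nonneg (h0 : 0 < lam) (ht : 0 < t) : 0 ≤ bottomParam lam t := by
  unfold bottomParam; positivity

theorem leftParam_nonneg (h0 : 0 < lam) (ht : 0 < t) : 0 ≤ leftParam lam t := by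
  unfold leftParam; positivity

theorem bottomParam_lt_one (h1 : lam < 1) (ht : 0 < t) : bottomParam lam t < 1 := by
  unfold bottomParam; rw [div_lt_one (by linarith)]; linarith

theorem leftParam_lt_one (h0 : 0 < lam) (h1 : lam < 1) (ht : 0 < t) : leftParam lam t < 1 := by
  unfold leftParam; rw [div_lt_one (by linarith)]; nlinarith

theorem bottomMean_eq (h1 : lam < 1) (ht : 0 < t) :
    bottomParam lam t / (1 - bottomParam lam t) = bottomMean lam t := by
  have h2 : 1 - lam ≠ 0 := by linarith
  have h3 : 1 - (t + lam) / (1 + t) = (1 - lam) / (1 + t) := by field_simp; ring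
  unfold bottomParam bottomMean; rw [h3]; field_simp

theorem leftMean_eq (h0 : 0 < lam) (h1 : lam < 1) (ht : 0 < t) :
    leftParam lam t / (1 - leftParam lam t) = leftMean lam t := by
  have h2 : 1 - lam ≠ 0 := by linarith
  have h3 : 1 - lam * (1 + t) / (t + lam) = (1 - lam) * t / (t + lam) := by field_simp; ring
  unfold leftParam leftMean; rw [h3]; field_simp

theorem bottomMean_nonneg (h0 : 0 < lam) (h1 : lam < 1) (ht : 0 < t) : 0 ≤ bottomMean lam t := by
  have : 0 < 1 - lam := by linarith
  unfold bottomMean; positivity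

theorem leftMean_nonneg (h0 : 0 < lam) (h1 : lam < 1) (ht : 0 < t) : 0 ≤ leftMean lam t := by
  have : 0 < 1 - lam := by linarith
  unfold leftMean; positivity

theorem bottomMean_add_leftMean (h1 : lam < 1) {β s : ℝ} (hs0 : 0 < s) (hs : s ^ 2 = β * lam) :
    bottomMean lam s + β * leftMean lam s = (1 + s) ^ 2 / (1 - lam) - 1 := by
  have h2 : 1 - lam ≠ 0 := by linarith
  have h3 : β * leftMean lam s = s * (1 + s) / (1 - lam) := by
    unfold leftMean
    rw [← mul_div_assoc, ← mul_assoc, ← hs]; field_simp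
  rw [h3]; unfold bottomMean; field_simp; ring

/-- Raising the parameter makes long initial stretches on the bottom row strictly suboptimal. -/
theorem exists_bottom_gap (h1 : lam < 1) {β s ε : ℝ} (hs0 : 0 < s) (hs : s ^ 2 = β * lam)
    (hε : 0 < ε) :
    ∃ t, 0 < t ∧ bottomMean lam s ≤ bottomMean lam t ∧
      bottomMean lam t + β * leftMean lam t - ε * (bottomMean lam t - bottomMean lam s) <
        bottomMean lam s + β * leftMean lam s := by
  have h2 : 0 < 1 - lam := by linarith
  -- The excess at s + τ is τ²/((1 - λ)(s + τ)) and the gain is ετ/(1 - λ), so τ < ε(s + τ) is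
  -- needed.
  set τ := ε * s with hτ
  have hτ0 : 0 < τ := by positivity
  have hL : ∀ t, 0 < t → β * leftMean lam t = s ^ 2 * (1 + t) / ((1 - lam) * t) := fun t _ => by
    unfold leftMean
    rw [hs]; ring
  refine ⟨s + τ, by positivity, ?_, ?_⟩
  · unfold bottomMean; gcongr; linarith
  rw [hL _ hs0, hL (s + τ) (by positivity), ← sub_pos]
  have : (s + lam) / (1 - lam) + s ^ 2 * (1 + s) / ((1 - lam) * s) -
      ((s + τ + lam) / (1 - lam) + s ^ 2 * (1 + (s + τ)) / ((1 - lam) * (s + τ)) -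
        ε * ((s + τ + lam) / (1 - lam) - (s + lam) / (1 - lam))) =
      τ * (ε * (s + τ) - τ) / ((1 - lam) * (s + τ)) := by
    field_simp; ring
  unfold bottomMean
  rw [this]
  have h3 : ε * (s + τ) - τ = ε * τ := by rw [hτ]; ring
  rw [h3]; positivity

/-- Lowering the parameter makes long initial stretches on the left column strictly
suboptimal. -/
theorem exists_left_gap (h0 : 0 < lam) (h1 : lam < 1) {β s ε : ℝ} (hs0 : 0 < s)
    (hs : s ^ 2 = β * lam) (hε : 0 < ε) :
    ∃ t, 0 < t ∧ leftMean lam s ≤ leftMean lam t ∧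
      bottomMean lam t + β * leftMean lam t - ε * (leftMean lam t - leftMean lam s) <
        bottomMean lam s + β * leftMean lam s := by
  have h2 : 0 < 1 - lam := by linarith
  -- At s - τ the excess is τ²/((1 - λ)(s - τ)) and the gain is ελτ/((1 - λ)s(s - τ)), whence τs <
  -- ελ.
  obtain ⟨τ, hτ0, hτs, hτ⟩ : ∃ τ, 0 < τ ∧ τ < s ∧ τ * s < ε * lam := by
    refine ⟨min (s / 2) (ε * lam / (2 * s)), by positivity, ?_, ?_⟩
    · exact (min_le_left _ _).trans_lt (by linarith)
    · calc _ ≤ ε * lam / (2 * s) * s := by gcongr; exact min_le_right _ _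
        _ = ε * lam / 2 := by field_simp
        _ < _ := by have : 0 < ε * lam := by positivity
                    linarith
  have hsτ : 0 < s - τ := by linarith
  have hL : ∀ t, 0 < t → β * leftMean lam t = s ^ 2 * (1 + t) / ((1 - lam) * t) := fun t _ => by
    unfold leftMean
    rw [hs]; ring
  have hdiff : leftMean lam (s - τ) - leftMean lam s = lam * τ / ((1 - lam) * (s * (s - τ))) := by
    unfold leftMean; field_simp; ring
  refine ⟨s - τ, hsτ, ?_, ?_⟩
  · rw [← sub_nonneg, hdiff]; positivity
  rw [hL _ hs0, hL (s - τ) hsτ, hdiff, ← sub_pos]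
  have : (s + lam) / (1 - lam) + s ^ 2 * (1 + s) / ((1 - lam) * s) -
      ((s - τ + lam) / (1 - lam) + s ^ 2 * (1 + (s - τ)) / ((1 - lam) * (s - τ)) -
        ε * (lam * τ / ((1 - lam) * (s * (s - τ))))) =
      τ * (ε * lam - τ * s) / ((1 - lam) * (s * (s - τ))) := by
    field_simp; ring
  unfold bottomMean
  rw [this]
  have h3 : 0 < ε * lam - τ * s := by linarith
  positivity

end Parameters

/-! ### Comparison of three models with a common bulk. -/

/-- All partial sums of the boundary weights, and the passage value at `(N, M)`, are within
`η * N` of their means in the model of index `t`. -/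
structure IsTypical (lam t η : ℝ) (h v : ℕ → ℕ) (w : ℕ × ℕ → ℕ) (N M : ℕ) : Prop where
  bottom : ∀ z ≤ N, |((∑ k ∈ Finset.range z, h k : ℕ) : ℝ) - z * bottomMean lam t| ≤ η * N
  left : ∀ z ≤ M, |((∑ k ∈ Finset.range z, v k : ℕ) : ℝ) - z * leftMean lam t| ≤ η * N
  vert : |((∑ k ∈ Finset.range M, vertIncr h v w N k : ℕ) : ℝ) - M * leftMean lam t| ≤ η * N

theorem IsTypical.abs_sub_le {lam t η : ℝ} {h v : ℕ → ℕ} {w : ℕ × ℕ → ℕ} {N M : ℕ}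
    (H : IsTypical lam t η h v w N M) :
    |(boundaryLPP h v w N M : ℝ) - (N * bottomMean lam t + M * leftMean lam t)| ≤ 2 * η * N := by
  have h1 := abs_le.1 (H.bottom N le_rfl)
  have h2 := abs_le.1 H.vert
  rw [boundaryLPP_eq_sum_add_sum_vertIncr, Nat.cast_add, abs_le]
  constructor <;> linarith [h1.1, h1.2, h2.1, h2.2]

theorem exists_forall_isTypical {lam β s δ : ℝ} (h0 : 0 < lam) (h1 : lam < 1) (hβ : 0 < β)
    (hs0 : 0 < s) (hs : s ^ 2 = β * lam) (hδ : 0 < δ) :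
    ∃ t : Fin 3 → ℝ, (∀ k, 0 < t k) ∧ ∃ η > 0, ∃ N₀ : ℕ, ∀ N : ℕ, N₀ ≤ N → 1 ≤ N →
      ∀ (h v : Fin 3 → ℕ → ℕ) (w : ℕ × ℕ → ℕ),
        (∀ k, IsTypical lam (t k) η (h k) (v k) w N ⌊β * (N : ℝ)⌋₊) →
        |(boundaryLPP 0 0 w N ⌊β * (N : ℝ)⌋₊ : ℝ) - N * ((1 + s) ^ 2 / (1 - lam) - 1)| ≤ δ * N := by
  set A := bottomMean lam with hA
  set B := leftMean lam with hB
  have hA0 : 0 ≤ A s := bottomMean_nonneg h0 h1 hs0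
  have hB0 : 0 ≤ B s := leftMean_nonneg h0 h1 hs0
  -- A boundary stretch shorter than εN has mean at most δN/2.
  obtain ⟨ε, hε, hεA, hεB⟩ : ∃ ε > 0, ε * A s ≤ δ / 2 ∧ ε * B s ≤ δ / 2 := by
    refine ⟨δ / (2 * (A s + B s + 1)), by positivity, ?_, ?_⟩
    · rw [div_mul_eq_mul_div, div_le_div_iff₀ (by positivity) (by positivity)]
      nlinarith
    · rw [div_mul_eq_mul_div, div_le_div_iff₀ (by positivity) (by positivity)]
      nlinarith
  obtain ⟨t1, ht1, hm1, hg1⟩ := exists_bottom_gap h1 hs0 hs hε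
  obtain ⟨t2, ht2, hm2, hg2⟩ := exists_left_gap h0 h1 hs0 hs hε
  set F := A s + β * B s with hF
  have hB1 : 0 ≤ B t1 := leftMean_nonneg h0 h1 ht1
  have hB2 : 0 ≤ B t2 := leftMean_nonneg h0 h1 ht2
  -- A long stretch accumulates 7η: 3η from `hlow`, η from each of the two boundary sums, 2η from
  -- the comparison model. A short one costs 3η + η.
  obtain ⟨η, hη, hηδ, hη1, hη2⟩ : ∃ η > 0, 4 * η ≤ δ / 2 ∧
      7 * η < F - (A t1 + β * B t1 - ε * (A t1 - A s)) ∧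
      7 * η < F - (A t2 + β * B t2 - ε * (B t2 - B s)) := by
    have hx := sub_pos.2 hg1
    have hy := sub_pos.2 hg2
    set x := F - (A t1 + β * B t1 - ε * (A t1 - A s))
    set y := F - (A t2 + β * B t2 - ε * (B t2 - B s))
    refine ⟨min (δ / 8) (min (x / 8) (y / 8)), by positivity, ?_, ?_, ?_⟩
    · linarith [min_le_left (δ / 8) (min (x / 8) (y / 8))]
    · linarith [(min_le_right (δ / 8) (min (x / 8) (y / 8))).trans (min_le_left _ _)]
    · linarith [(min_le_right (δ / 8) (min (x / 8) (y / 8))).trans (min_le_right _ _)]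
  -- Beyond `N₀`, replacing ⌊βN⌋ by βN costs at most ηN; this is the third η in `hlow`.
  obtain ⟨N₀, hN₀⟩ := exists_nat_ge (B s / η)
  refine ⟨![s, t1, t2], ?_, η, hη, N₀, ?_⟩
  · intro k; fin_cases k <;> simpa
  intro N hN hN1 h v w H
  rw [← bottomMean_add_leftMean h1 hs0 hs]
  have H0 : IsTypical lam s η (h 0) (v 0) w N ⌊β * (N : ℝ)⌋₊ := H 0
  have H1 : IsTypical lam t1 η (h 1) (v 1) w N ⌊β * (N : ℝ)⌋₊ := H 1
  have H2 : IsTypical lam t2 η (h 2) (v 2) w N ⌊β * (N : ℝ)⌋₊ := H 2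
  set M := ⌊β * (N : ℝ)⌋₊
  have hN0 : (0 : ℝ) ≤ N := N.cast_nonneg
  have hNpos : (0 : ℝ) < N := by exact_mod_cast hN1
  have hM1 : (M : ℝ) ≤ β * N := Nat.floor_le (by positivity)
  have hM2 : β * N - 1 ≤ M := by linarith [Nat.lt_floor_add_one (β * (N : ℝ))]
  have hBN : B s ≤ η * N := by
    have : (N₀ : ℝ) ≤ N := by exact_mod_cast hN
    have h3 := hN₀.trans this
    rw [div_le_iff₀ hη] at h3
    linarith
  change |(boundaryLPP 0 0 w N M : ℝ) - N * F| ≤ δ * N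
  have hS0 := abs_le.1 H0.abs_sub_le
  have hS1 := (abs_le.1 H1.abs_sub_le).2
  have hS2 := (abs_le.1 H2.abs_sub_le).2
  rw [← hA, ← hB] at hS0 hS1 hS2
  have hM3 : (M : ℝ) * B s ≤ β * N * B s := by gcongr
  have hM4 : (β * N - 1) * B s ≤ M * B s := by gcongr
  have hM5 : (M : ℝ) * B t1 ≤ β * N * B t1 := by gcongr
  have hM6 : (M : ℝ) * B t2 ≤ β * N * B t2 := by gcongr
  have hηδN := mul_le_mul_of_nonneg_right hηδ hN0
  have hlow : N * F - 3 * η * N ≤ (boundaryLPP (h 0) (v 0) w N M : ℝ) := by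
    rw [hF]; linarith [hS0.1]
  rw [abs_le]
  constructor
  · rcases boundaryLPP_exit (h 0) (v 0) w N M with ⟨z, hz, g, hg, hg'⟩ | ⟨z, hz, g, hg, hg'⟩
    · have e0 := hg' 0 0
      simp only [Pi.zero_apply, Finset.sum_const_zero, zero_add] at e0
      have e0' : (g : ℝ) ≤ boundaryLPP 0 0 w N M := by exact_mod_cast e0
      have e1 : ((∑ k ∈ Finset.range z, h 1 k : ℕ) : ℝ) + g ≤ boundaryLPP (h 1) (v 1) w N M := by
        exact_mod_cast hg' (h 1) (v 1)
      have b0 := (abs_le.1 (H0.bottom z hz)).2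
      have b1 := (abs_le.1 (H1.bottom z hz)).1
      rw [hg, Nat.cast_add] at hlow
      rcases le_or_gt (ε * N) z with hzε | hzε
      · exfalso
        have d1 : ε * N * (A t1 - A s) ≤ z * (A t1 - A s) := by
          gcongr
        have := mul_lt_mul_of_pos_right hη1 hNpos
        rw [← hA] at b0 b1
        linarith
      · have d1 : z * A s ≤ ε * N * A s := by gcongr
        have d2 := mul_le_mul_of_nonneg_right hεA hN0
        rw [← hA] at b0
        linarith
    · have e0 := hg' 0 0
      simp only [Pi.zero_apply, Finset.sum_const_zero, zero_add] at e0
      have e0' : (g : ℝ) ≤ boundaryLPP 0 0 w N M := by exact_mod_cast e0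
      have e1 : ((∑ k ∈ Finset.range z, v 2 k : ℕ) : ℝ) + g ≤ boundaryLPP (h 2) (v 2) w N M := by
        exact_mod_cast hg' (h 2) (v 2)
      have b0 := (abs_le.1 (H0.left z hz)).2
      have b1 := (abs_le.1 (H2.left z hz)).1
      rw [hg, Nat.cast_add] at hlow
      rcases le_or_gt (ε * N) z with hzε | hzε
      · exfalso
        have d1 : ε * N * (B t2 - B s) ≤ z * (B t2 - B s) := by
          gcongr
        have := mul_lt_mul_of_pos_right hη2 hNpos
        rw [← hB] at b0 b1
        linarith
      · have d1 : z * B s ≤ ε * N * B s := by gcongr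
        have d2 := mul_le_mul_of_nonneg_right hεB hN0
        rw [← hB] at b0
        linarith
  · have := boundaryLPP_zero_le (h 0) (v 0) w N M
    have e0 : (boundaryLPP 0 0 w N M : ℝ) ≤ boundaryLPP (h 0) (v 0) w N M := by exact_mod_cast this
    rw [hF]
    linarith [hS0.2]

/-! ### Typicality in the stationary model, and transfer between spaces. -/

section Typical

variable {Ω : Type*} [MeasurableSpace Ω] {P : Measure Ω} [IsProbabilityMeasure P]

theorem expSmall_not_isTypical {lam t η β : ℝ} (h0 : 0 < lam) (h1 : lam < 1) (ht : 0 < t)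
    (hη : 0 < η) (hβ : 0 < β) {ζ : ℕ ⊕ ℕ ⊕ (ℕ × ℕ) → Ω → ℕ}
    (hζ : IsGeomField P (stationaryParam (bottomParam lam t) (leftParam lam t)) ζ) :
    ExpSmall P fun N => {ω | ¬ IsTypical lam t η (fun k => ζ (.inl k) ω)
      (fun k => ζ (.inr (.inl k)) ω) (fun y => ζ (.inr (.inr y)) ω) N ⌊β * (N : ℝ)⌋₊} := by
  have ha0 := bottomParam_nonneg h0 ht
  have ha1 := bottomParam_lt_one h1 ht
  have hb0 := leftParam_nonneg h0 ht
  have hb1 := leftParam_lt_one h0 h1 ht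
  obtain ⟨c, hc, hB⟩ := exists_chernoff_geom P ha0 ha1 (K := 1) one_pos hη
  obtain ⟨d, hd, hL⟩ := exists_chernoff_geom P hb0 hb1 (K := β) hβ hη
  rw [bottomMean_eq h1 ht] at hB
  rw [leftMean_eq h0 h1 ht] at hL
  have hfB : IsGeomField P (fun _ => bottomParam lam t) (fun k : ℕ => ζ (.inl k)) :=
    hζ.precomp (f := fun k : ℕ => .inl k) fun x y hxy => by simpa using hxy
  have hfL : IsGeomField P (fun _ => leftParam lam t) (fun k : ℕ => ζ (.inr (.inl k))) :=
    hζ.precomp (f := fun k : ℕ => .inr (.inl k)) fun x y hxy => by simpa using hxy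
  have s1 := expSmall_biUnion (P := P) hc two_pos (K := 1)
    one_pos (A := fun N n => {ω | η * N < |((∑ i ∈ Finset.range n, ζ (.inl i) ω : ℕ) : ℝ) -
      n * bottomMean lam t|}) fun N n _ hn => hB _ hfB N n hn
  have s2 := expSmall_biUnion (P := P) hd two_pos (K := β) hβ
    (A := fun N n => {ω | η * N < |((∑ i ∈ Finset.range n, ζ (.inr (.inl i)) ω : ℕ) : ℝ) -
      n * leftMean lam t|}) fun N n _ hn => hL _ hfL N n hn
  have s3 : ExpSmall P fun N => {ω | η * N < |((∑ i ∈ Finset.range ⌊β * (N : ℝ)⌋₊,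
      vertIncr (fun k => ζ (.inl k) ω) (fun k => ζ (.inr (.inl k)) ω)
        (fun y => ζ (.inr (.inr y)) ω) N i : ℕ) : ℝ) - ⌊β * (N : ℝ)⌋₊ * leftMean lam t|} := by
    refine ⟨d, hd, 2, two_pos, fun N _ => ?_⟩
    -- The field `X` changes with N; this is allowed because the rate `d` was fixed before the
    -- field.
    obtain ⟨X, hX, hXV⟩ := hζ.exists_vertIncr ha0 ha1 hb0 hb1 N ⌊β * (N : ℝ)⌋₊
    refine le_of_eq_of_le ?_ (hL X hX N ⌊β * (N : ℝ)⌋₊ (Nat.floor_le (by positivity)))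
    congr 1
    ext ω
    simp only [Set.mem_ofPred_eq]
    rw [Finset.sum_congr rfl fun l hl => hXV l (Finset.mem_range.1 hl) ω]
  refine ((s1.union s2).union s3).of_eventually_subset (N₀ := 0) fun N _ _ ω hω => ?_
  by_contra hcon
  simp only [Set.mem_union, Set.mem_ofPred_eq, not_or, not_exists, not_and, not_lt] at hcon
  obtain ⟨⟨c1, c2⟩, c3⟩ := hcon
  refine hω ⟨fun z hz => c1 z ?_, fun z hz => c2 z ?_, c3⟩
  · rw [one_mul]; exact_mod_cast hz
  · exact (Nat.le_floor_iff (by positivity)).1 hz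

theorem measurable_boundaryLPP (N M : ℕ) :
    Measurable fun w : ℕ × ℕ → ℕ => boundaryLPP 0 0 w N M := by
  induction N generalizing M with
  | zero => simp only [boundaryLPP_left]; exact measurable_const
  | succ N ihN =>
    induction M with
    | zero => simp only [boundaryLPP_bottom]; exact measurable_const
    | succ M ihM =>
      simp only [boundaryLPP_succ_succ]
      exact ((ihN _).max ihM).add (measurable_pi_apply _)

/-- The parameters determine the joint law, so probabilities may be computed on an auxiliary space
that also carries boundary weights. -/
theorem IsGeomField.measureReal_eq {Ω' ι : Type*} [MeasurableSpace Ω'] {Q : Measure Ω'}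
    [IsProbabilityMeasure Q] {p : ι → ℝ} {ξ : ι → Ω → ℕ} {ζ : ι → Ω' → ℕ}
    (hξ : IsGeomField P p ξ) (hζ : IsGeomField Q p ζ) {A : Set (ι → ℕ)} (hA : MeasurableSet A) :
    P.real {ω | (fun a => ξ a ω) ∈ A} = Q.real {ω | (fun a => ζ a ω) ∈ A} := by
  have e1 := congrArg (fun μ : Measure (ι → ℕ) => μ.real A) (hξ.map_eq.trans hζ.map_eq.symm)
  rwa [map_measureReal_apply (measurable_pi_iff.2 hξ.measurable) hA,
    map_measureReal_apply (measurable_pi_iff.2 hζ.measurable) hA] at e1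

end Typical

/-! ### Coupling and conclusion. -/

/-- The event that the passage value deviates from its asymptotic value `g` by more than `δ`. -/
def deviationSet (β g δ : ℝ) (N : ℕ) : Set (ℕ × ℕ → ℕ) :=
  {w | δ < |(1 / (N : ℝ)) * (boundaryLPP 0 0 w N ⌊β * (N : ℝ)⌋₊ : ℝ) - g|}

theorem measurableSet_deviationSet (β g δ : ℝ) (N : ℕ) :
    MeasurableSet (deviationSet β g δ N) := by
  have h : Measurable fun w : ℕ × ℕ → ℕ => (boundaryLPP 0 0 w N ⌊β * (N : ℝ)⌋₊ : ℝ) :=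
    measurable_from_top.comp (measurable_boundaryLPP N _)
  exact measurableSet_lt measurable_const (by fun_prop)

theorem exists_deviation_bound {lam β δ : ℝ} (h0 : 0 < lam) (h1 : lam < 1) (hβ : 0 < β)
    (hδ : 0 < δ) :
    ∃ c > 0, ∃ C > 0, ∀ {Ω : Type u} [MeasurableSpace Ω] (P : Measure Ω) [IsProbabilityMeasure P]
      (ζ : ℕ × ℕ → Ω → ℕ), IsGeomField P (fun _ => lam) ζ → ∀ N : ℕ, 1 ≤ N →
      P.real {ω | (fun y => ζ y ω) ∈
        deviationSet β ((1 + Real.sqrt (β * lam)) ^ 2 / (1 - lam) - 1) δ N} ≤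
        C * Real.exp (-c * N) := by
  obtain ⟨t, ht, η, hη, N₀, H⟩ := exists_forall_isTypical h0 h1 hβ
    (Real.sqrt_pos.2 (mul_pos hβ h0)) (Real.sq_sqrt (mul_pos hβ h0).le) hδ
  -- Three separate boundaries share one bulk, which is possible since the boundary parameters
  -- multiply to λ for every index. Constants found on this one space serve every Ω.
  set p : (Fin 3 × (ℕ ⊕ ℕ)) ⊕ (ℕ × ℕ) → ℝ := Sum.elim (fun q => q.2.elim
    (fun _ => bottomParam lam (t q.1)) (fun _ => leftParam lam (t q.1))) (fun _ => lam) with hp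
  have hQ := isGeomField_infinitePi p
  set Q := Measure.infinitePi fun a => geomLaw (p a)
  have htyp : ∀ k : Fin 3, ExpSmall Q fun N => {x | ¬ IsTypical lam (t k) η
      (fun i => x (.inl (k, .inl i))) (fun i => x (.inl (k, .inr i))) (fun y => x (.inr y))
      N ⌊β * (N : ℝ)⌋₊} := by
    intro k
    set f : ℕ ⊕ ℕ ⊕ (ℕ × ℕ) → (Fin 3 × (ℕ ⊕ ℕ)) ⊕ (ℕ × ℕ) :=
      Sum.elim (fun i => .inl (k, .inl i)) (Sum.elim (fun i => .inl (k, .inr i)) .inr) with hf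
    have hinj : f.Injective := by
      rintro (x | x | x) (y | y | y) hxy <;> simp [hf] at hxy ⊢ <;> exact hxy
    have hpf : (fun a => p (f a)) =
        stationaryParam (bottomParam lam (t k)) (leftParam lam (t k)) := by
      funext a
      rcases a with x | x | x <;> simp [hp, hf, stationaryParam, bottomParam_mul_leftParam h0 (ht k)]
    have := hQ.precomp hinj
    rw [hpf] at this
    exact expSmall_not_isTypical h0 h1 (ht k) hη hβ this
  have hdev : ExpSmall Q fun N => {x | (fun y => x (.inr y)) ∈
      deviationSet β ((1 + Real.sqrt (β * lam)) ^ 2 / (1 - lam) - 1) δ N} := by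
    refine (((htyp 0).union (htyp 1)).union (htyp 2)).of_eventually_subset (N₀ := N₀)
      fun N hN hN1 x hx => ?_
    by_contra hcon
    simp only [Set.mem_union, Set.mem_ofPred_eq, not_or, not_not] at hcon
    have hNpos : (0 : ℝ) < N := by exact_mod_cast hN1
    have hb := H N hN hN1 (fun k i => x (.inl (k, .inl i))) (fun k i => x (.inl (k, .inr i)))
      (fun y => x (.inr y)) (fun k => by
        fin_cases k
        exacts [hcon.1.1, hcon.1.2, hcon.2])
    have hx' : δ < _ := hx
    refine absurd hx' (not_lt.2 ?_)
    refine le_of_mul_le_mul_right ?_ hNpos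
    refine le_of_eq_of_le ?_ hb
    rw [← abs_of_pos hNpos, ← abs_mul, abs_of_pos hNpos]
    congr 1
    field_simp
  obtain ⟨c, hc, C, hC, hle⟩ := hdev
  refine ⟨c, hc, C, hC, fun P _ ζ hζ N hN => ?_⟩
  refine le_of_eq_of_le ?_ (hle N hN)
  exact hζ.measureReal_eq (hQ.precomp (f := fun y => .inr y) Sum.inr_injective)
    (measurableSet_deviationSet _ _ _ _)

theorem IsIIDGeometric.isGeomField {Ω : Type u} [MeasurableSpace Ω] {P : Measure Ω}
    [IsProbabilityMeasure P] {lam : ℝ} (h0 : 0 < lam) (h1 : lam < 1) {ξ : ℕ+ × ℕ+ → Ω → ℕ}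
    (h : IsIIDGeometric P lam ξ) : IsGeomField P (fun _ => lam) ξ := by
  refine ⟨h.measurable, h.indep, fun y => Measure.ext_of_singleton fun k => ?_⟩
  rw [geomLaw_singleton h0.le h1, ← h.law y k, ofReal_measureReal,
    Measure.map_apply (h.measurable y) (measurableSet_singleton _)]
  rfl

theorem mainTheorem7 (lam β : ℝ) (hlam0 : 0 < lam) (hlam1 : lam < 1) (hβ : 0 < β) :
    (∀ (Ω : Type u) [MeasurableSpace Ω] (P : Measure Ω) [IsProbabilityMeasure P]
        (ξ : ℕ+ × ℕ+ → Ω → ℕ), IsIIDGeometric P lam ξ →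
        ∀ᵐ ω ∂P, Tendsto
          (fun N : ℕ => (1 / (N : ℝ)) * (lastPassage (fun y => ξ y ω) N ⌊β * (N : ℝ)⌋₊ : ℝ))
          atTop (𝓝 ((1 + Real.sqrt (β * lam)) ^ 2 / (1 - lam) - 1))) ∧
    (∀ δ : ℝ, 0 < δ → ∃ c : ℝ, 0 < c ∧ ∃ C : ℝ, 0 < C ∧
      ∀ (Ω : Type u) [MeasurableSpace Ω] (P : Measure Ω) [IsProbabilityMeasure P]
        (ξ : ℕ+ × ℕ+ → Ω → ℕ), IsIIDGeometric P lam ξ →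
        ∀ N : ℕ, 1 ≤ N →
          P.real {ω | δ < |(1 / (N : ℝ)) *
                (lastPassage (fun y => ξ y ω) N ⌊β * (N : ℝ)⌋₊ : ℝ) -
              ((1 + Real.sqrt (β * lam)) ^ 2 / (1 - lam) - 1)|}
            ≤ C * Real.exp (-c * (N : ℝ))) := by
  have main : ∀ δ : ℝ, 0 < δ → ∃ c : ℝ, 0 < c ∧ ∃ C : ℝ, 0 < C ∧
      ∀ (Ω : Type u) [MeasurableSpace Ω] (P : Measure Ω) [IsProbabilityMeasure P]
        (ξ : ℕ+ × ℕ+ → Ω → ℕ), IsIIDGeometric P lam ξ →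
        ∀ N : ℕ, 1 ≤ N →
          P.real {ω | δ < |(1 / (N : ℝ)) *
                (lastPassage (fun y => ξ y ω) N ⌊β * (N : ℝ)⌋₊ : ℝ) -
              ((1 + Real.sqrt (β * lam)) ^ 2 / (1 - lam) - 1)|}
            ≤ C * Real.exp (-c * (N : ℝ)) := by
    intro δ hδ
    obtain ⟨c, hc, C, hC, h⟩ := exists_deviation_bound hlam0 hlam1 hβ hδ
    refine ⟨c, hc, C, hC, fun Ω _ P _ ξ hξ N hN => ?_⟩
    simp only [lastPassage_eq_boundaryLPP]
    exact h P _ ((hξ.isGeomField hlam0 hlam1).precomp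
      (f := fun y : ℕ × ℕ => (y.1.succPNat, y.2.succPNat)) (fun x y hxy => by
        simpa [Prod.ext_iff] using hxy)) N hN
  refine ⟨fun Ω _ P _ ξ hξ => ?_, main⟩
  -- Countably many tolerances 1/(k + 1) allow one null set for all of them.
  have hae : ∀ᵐ ω ∂P, ∀ k : ℕ, ∀ᶠ N : ℕ in atTop, ¬ ((1 / ((k : ℝ) + 1)) <
      |(1 / (N : ℝ)) * (lastPassage (fun y => ξ y ω) N ⌊β * (N : ℝ)⌋₊ : ℝ) -
        ((1 + Real.sqrt (β * lam)) ^ 2 / (1 - lam) - 1)|) := by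
    refine ae_all_iff.2 fun k => ?_
    obtain ⟨c, hc, C, hC, h⟩ := main (1 / ((k : ℝ) + 1)) (by positivity)
    exact ExpSmall.ae_eventually_notMem ⟨c, hc, C, hC, h Ω P ξ hξ⟩
  filter_upwards [hae] with ω hω
  rw [Metric.tendsto_nhds]
  intro ε hε
  obtain ⟨k, hk⟩ := exists_nat_one_div_lt hε
  filter_upwards [hω k] with N hN
  rw [Real.dist_eq]
  exact (not_lt.1 hN).trans_lt hk
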